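/- Let $q$ be a prime power and let $\mathcal C\subseteq \mathrm{GF}(q)^\nu$ be a linear code of length $\nu$ with minimum distance $d$. Let $\mathcal C^\perp$ be its dual code with respect to the standard bilinear form $\sum_i x_iy_i$, and let $d^\perp$ be the minimum distance of $\mathcal C^\perp$. Write $\mathcal P$ for the set of the $\nu$ coordinate positions, $\mathrm{Supp}(\mathbf c)=\{i: c_i\neq 0\}$ and $\mathrm{wt}(\mathbf c)=\#\mathrm{Supp}(\mathbf c)$. For a linear code $\mathcal D$, let $A_k(\mathcal D)$ be the number of codewords of $\mathcal D$ of weight $k$. If $\mathcal D$ has length $\nu$, let $\mathcal B_k(\mathcal D)$ be the multiset obtained from the multiset $\{\{\mathrm{Supp}(\mathbf c): \mathbf c\in\mathcal D,\ \mathrm{wt}(\mathbf c)=k\}\}$ by dividing all multiplicities by $q-1$. (For $k\ge 1$ this division is exact; for $k=0$ multiplicities are rounded down.) For $1\le t\le\nu$ and $0\le k\le \nu$, a multiset $\mathcal B$ of $k$-subsets of $\mathcal P$ forms a $t$-design $(\mathcal P,\mathcal B)$ if there is an integer $\lambda\ge 0$ such that every $t$-subset of $\mathcal P$ is contained in exactly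 $\lambda$ members of $\mathcal B$, counted with multiplicity. The case $\lambda=0$ is allowed; in particular $(\mathcal P,\mathcal B_0(\mathcal D))$ is always a $t$-design, with $\lambda=0$. For a set $T$ of coordinate positions, the punctured code $\mathcal C^T$ is obtained by deleting the coordinates in $T$ from all codewords of $\mathcal C$, and the shortened code $\mathcal C_T$ is obtained by deleting the coordinates in $T$ from those codewords of $\mathcal C$ that are zero on $T$. Let $t$ be an integer with $0<t<\min\{d,d^\perp\}$. Then the following statements are equivalent. (1) $(\mathcal P,\mathcal B_k(\mathcal C))$ is a $t$-design for every $0\le k\le \nu$. (2) $(\mathcal P,\mathcal B_k(\mathcal C^\perp))$ is a $t$-design for every $0\le k\le \nu$. (3) For every $1\le t'\le t$, the weight distribution $(A_k(\mathcal C_T))_{k=0}^{\nu-t'}$ of the shortened code $\mathcal C_T$ is the same for all sets $T$ of $t'$ coordinate positions. (4) For every $1\le t'\le t$, the weight distribution $(A_k(\mathcal C^T))_{k=0}^{\nu-t'}$ of the punctured code $\mathcal C^T$ is the same for all sets $T$ of $t'$ coordinate positions. -/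

import Mathlib

/-- The pair `(ι, B)` is a `t`-`(ν, k, lam)` design, where `ν = #ι`: `1 ≤ t ≤ ν`, `k ≤ ν`, the
multiset `B` consists of `k`-subsets of `ι`, and every `t`-subset of `ι` is contained in exactly
`lam` members of `B` (counted with multiplicity). Repeated blocks and `B = 0` are allowed. -/
structure IsDesign {ι : Type*} [Fintype ι] [DecidableEq ι]
    (t k lam : ℕ) (B : Multiset (Finset ι)) : Prop where
  one_le : 1 ≤ t
  le_card : t ≤ Fintype.card ι
  size_le : k ≤ Fintype.card ι
  card_block : ∀ b ∈ B, b.card = k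
  card_containing : ∀ T : Finset ι, T.card = t → (B.filter (fun b => T ⊆ b)).card = lam

/-- The multiset obtained from `S` by dividing all multiplicities by `m`. -/
def divMultiplicity {α : Type*} [DecidableEq α] (m : ℕ) (S : Multiset α) : Multiset α :=
  ∑ a ∈ S.toFinset, Multiset.replicate (S.count a / m) a

namespace LinearCode

variable {F ι : Type*} [Field F] [Fintype F] [DecidableEq F] [Fintype ι] [DecidableEq ι]

/-- The support of a word. -/
def supp (c : ι → F) : Finset ι := Finset.univ.filter (fun i => c i ≠ 0)

/-- The minimum Hamming distance between distinct codewords (`0` for the zero code). -/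
noncomputable def minDist (C : Submodule F (ι → F)) : ℕ :=
  sInf {m : ℕ | ∃ x ∈ C, ∃ y ∈ C, x ≠ y ∧ hammingDist x y = m}

/-- The dual code, with respect to the standard bilinear form `∑ i, x i * y i`. -/
def dual (C : Submodule F (ι → F)) : Submodule F (ι → F) :=
  C.orthogonalBilin (dotProductBilin F F)

/-- The codewords of weight `w`. -/
noncomputable def wordsOfWeight (C : Submodule F (ι → F)) (w : ℕ) : Finset (ι → F) := by
  classical exact Finset.univ.filter (fun c => c ∈ C ∧ hammingNorm c = w)

/-- `A_w(C)`, the number of codewords of weight `w`. -/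
noncomputable def weightCount (C : Submodule F (ι → F)) (w : ℕ) : ℕ :=
  (wordsOfWeight C w).card

/-- The multiset `(1 / (q - 1)) {{ Supp(c) : c ∈ C, wt(c) = w }}`. For `w ≥ 1` the division is
exact, since the nonzero multiples of a codeword have the same support. For `w = 0` the only
possible block is the empty set, with multiplicity `⌊1 / (q - 1)⌋`; it contains no `t`-subset with
`t ≥ 1`, so its multiplicity plays no role. -/
noncomputable def blocks (C : Submodule F (ι → F)) (w : ℕ) : Multiset (Finset ι) :=
  divMultiplicity (Fintype.card F - 1) ((wordsOfWeight C w).val.map supp)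

/-- `(P(C), B_k(C))` is a `t`-design for every `0 ≤ k ≤ ν`. -/
def SupportsDesigns (C : Submodule F (ι → F)) (t : ℕ) : Prop :=
  ∀ k ≤ Fintype.card ι, ∃ lam : ℕ, IsDesign t k lam (blocks C k)

/-- The punctured code `C^T`: the coordinates in `T` are deleted from all codewords. -/
def puncture (C : Submodule F (ι → F)) (T : Finset ι) : Submodule F ({i : ι // i ∉ T} → F) :=
  C.map (LinearMap.funLeft F F (Subtype.val : {i : ι // i ∉ T} → ι))

/-- The subcode `C(T)` of the codewords that vanish on `T`. -/
def vanishingOn (C : Submodule F (ι → F)) (T : Finset ι) : Submodule F (ι → F) :=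
  C ⊓ Submodule.pi (T : Set ι) (fun _ => ⊥)

/-- The shortened code `C_T`: the subcode `C(T)` punctured on `T`. -/
def shorten (C : Submodule F (ι → F)) (T : Finset ι) : Submodule F ({i : ι // i ∉ T} → F) :=
  puncture (vanishingOn C T) T

end LinearCode

namespace LinearCode

variable {F ι κ : Type*} [Field F] [Fintype F] [DecidableEq F] [Fintype ι] [DecidableEq ι]
  [Fintype κ] [DecidableEq κ]

/-! ### Duality -/

/-! Everything is read off the number `countIn C k A B` of words of weight `k` that are nonzero on
`A` and zero on `B`. A set lying in no zero support of interest is harmless, so the blocks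
containing a nonempty `A` number `countIn C k A ∅ / (q - 1)`. The design property thus says that
this depends only on `#A` for `#A = t`, and double counting extends it to `#A ≤ t`
(`supportsDesigns_iff_nonzeroRegular`). Inclusion-exclusion trades nonzero for zero conditions
(`nonzeroRegular_iff_zeroRegular`), and `countIn C k ∅ T` is the weight distribution of `C_T`; this
gives (1) ↔ (3).

Since `t < d`, puncturing on at most `t` positions is injective, so the weights of `C^T` are sums of
values of `countIn` and depend only on `#T` (`weightCount_puncture_congr`). The dual of `C^T` is the
shortening of `C^⊥` on `T` (`dual_puncture`), and by MacWilliams a code and its dual determine each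
other's weight distributions. Hence regularity passes from `C` to `C^⊥`, and back because `t < d^⊥`.
The same duality turns (4) for `C` into (3) for `C^⊥`, which gives (2) ↔ (4). -/

omit [Fintype F] [DecidableEq F] [DecidableEq ι] in
theorem mem_dual {C : Submodule F (ι → F)} {y : ι → F} :
    y ∈ dual C ↔ ∀ x ∈ C, ∑ i, x i * y i = 0 :=
  Iff.rfl

omit [Fintype F] [DecidableEq F] in
theorem dotProductBilin_nondegenerate :
    LinearMap.BilinForm.Nondegenerate (dotProductBilin F F : LinearMap.BilinForm F (ι → F)) := by
  constructor
  · intro x hx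
    ext i
    simpa using hx (Pi.single i 1)
  · intro x hx
    ext i
    simpa using hx (Pi.single i 1)

omit [Fintype F] [DecidableEq F] [DecidableEq ι] in
theorem dotProductBilin_isRefl :
    LinearMap.BilinForm.IsRefl (dotProductBilin F F : LinearMap.BilinForm F (ι → F)) := by
  intro x y h
  simpa [dotProduct_comm] using h

omit [Fintype F] [DecidableEq F] in
theorem dual_dual (C : Submodule F (ι → F)) : dual (dual C) = C :=
  LinearMap.BilinForm.orthogonal_orthogonal dotProductBilin_nondegenerate
    dotProductBilin_isRefl C

omit [Fintype F] [DecidableEq F] in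
theorem finrank_dual (C : Submodule F (ι → F)) :
    Module.finrank F (dual C) = Fintype.card ι - Module.finrank F C := by
  rw [← Module.finrank_fintype_fun_eq_card F (η := ι)]
  exact LinearMap.BilinForm.finrank_orthogonal dotProductBilin_nondegenerate C

omit [Fintype F] [DecidableEq F] [Fintype ι] [DecidableEq ι] in
theorem mem_vanishingOn {C : Submodule F (ι → F)} {T : Finset ι} {c : ι → F} :
    c ∈ vanishingOn C T ↔ c ∈ C ∧ ∀ i ∈ T, c i = 0 := by
  simp [vanishingOn, Submodule.mem_pi]

omit [Fintype F] [DecidableEq F] [DecidableEq ι] in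
theorem finrank_vanishingOn_top (S : Finset ι) :
    Module.finrank F (vanishingOn (⊤ : Submodule F (ι → F)) S) + S.card = Fintype.card ι := by
  have hker : vanishingOn (⊤ : Submodule F (ι → F)) S =
      LinearMap.ker (LinearMap.funLeft F F (Subtype.val : S → ι)) := by
    ext c
    simp [mem_vanishingOn, funext_iff, LinearMap.funLeft_apply]
  have h := LinearMap.finrank_range_add_finrank_ker
    (LinearMap.funLeft F F (Subtype.val : S → ι))
  rw [LinearMap.range_eq_top.2
    (LinearMap.funLeft_surjective_of_injective F F _ Subtype.val_injective), finrank_top,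
    Module.finrank_fintype_fun_eq_card, Module.finrank_fintype_fun_eq_card,
    Fintype.card_coe] at h
  rw [hker]
  omega

omit [Fintype F] [DecidableEq F] in
theorem vanishingOn_dual_compl (C : Submodule F (ι → F)) (S : Finset ι) :
    vanishingOn (dual C) Sᶜ = dual (C ⊔ vanishingOn ⊤ S) := by
  ext y
  rw [mem_vanishingOn]
  constructor
  · rintro ⟨hy, hy0⟩
    rw [mem_dual] at hy ⊢
    intro x hx
    obtain ⟨a, ha, b, hb, rfl⟩ := Submodule.mem_sup.1 hx
    have hb0 : ∑ i, b i * y i = 0 := by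
      refine Finset.sum_eq_zero fun i _ => ?_
      by_cases hi : i ∈ S
      · rw [(mem_vanishingOn.1 hb).2 i hi, zero_mul]
      · rw [hy0 i (by simpa using hi), mul_zero]
    simp only [Pi.add_apply, add_mul, Finset.sum_add_distrib, hy a ha, hb0, add_zero]
  · intro hy
    rw [mem_dual] at hy
    refine ⟨mem_dual.2 fun x hx => hy x (Submodule.mem_sup_left hx), fun i hi => ?_⟩
    have := hy (Pi.single i 1) (Submodule.mem_sup_right (mem_vanishingOn.2
      ⟨trivial, fun j hj => Pi.single_eq_of_ne (by rintro rfl; simp_all) _⟩))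
    simpa [Pi.single_apply] using this

-- A dimension count: the dual words vanishing off `S` form the dual of the sum of `C` and all words
-- vanishing on `S`. Summed over `S` of fixed size, this yields MacWilliams.
omit [DecidableEq F] in
theorem card_vanishingOn_dual_compl (C : Submodule F (ι → F)) (S : Finset ι) :
    Nat.card C * Nat.card (vanishingOn (dual C) Sᶜ) =
      Nat.card (vanishingOn C S) * Fintype.card F ^ S.card := by
  have hinf : vanishingOn C S = C ⊓ vanishingOn ⊤ S := by simp [vanishingOn]
  have h₁ := Submodule.finrank_sup_add_finrank_inf_eq C (vanishingOn ⊤ S)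
  have h₂ := finrank_vanishingOn_top (F := F) S
  have h₃ := Submodule.finrank_le (C ⊔ vanishingOn ⊤ S)
  rw [Module.finrank_fintype_fun_eq_card] at h₃
  rw [vanishingOn_dual_compl, Module.natCard_eq_pow_finrank (K := F) (V := C),
    Module.natCard_eq_pow_finrank (K := F) (V := dual (C ⊔ vanishingOn ⊤ S)),
    Module.natCard_eq_pow_finrank (K := F) (V := vanishingOn C S), finrank_dual, hinf,
    Nat.card_eq_fintype_card, ← pow_add, ← pow_add]
  congr 1
  omega

/-! ### Weight distributions -/

omit [Fintype F] [DecidableEq ι] in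
theorem card_supp (c : ι → F) : (supp c).card = hammingNorm c := rfl

omit [Fintype F] [DecidableEq ι] in
theorem mem_supp {c : ι → F} {i : ι} : i ∈ supp c ↔ c i ≠ 0 := by
  simp [supp]

theorem mem_wordsOfWeight {C : Submodule F (ι → F)} {w : ℕ} {c : ι → F} :
    c ∈ wordsOfWeight C w ↔ c ∈ C ∧ hammingNorm c = w := by
  simp [wordsOfWeight]

theorem weightCount_eq_zero (C : Submodule F (ι → F)) {w : ℕ} (hw : Fintype.card ι < w) :
    weightCount C w = 0 := by
  rw [weightCount, Finset.card_eq_zero, Finset.eq_empty_iff_forall_notMem]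
  intro c hc
  have := (mem_wordsOfWeight.1 hc).2
  have := hammingNorm_le_card_fintype (x := c)
  omega

-- Double counting of pairs `(S, c)` with `c` zero on `S`: a word of weight `w` has `ν - w` zeros
-- from which to choose `S`.
open Classical in
theorem sum_card_vanishingOn (C : Submodule F (ι → F)) (r : ℕ) :
    ∑ S ∈ Finset.powersetCard r Finset.univ, Nat.card (vanishingOn C S) =
      ∑ w ∈ Finset.range (Fintype.card ι + 1),
        weightCount C w * (Fintype.card ι - w).choose r := by
  have h₁ : ∀ S : Finset ι, Nat.card (vanishingOn C S) =
      ∑ c with c ∈ C, if S ⊆ (supp c)ᶜ then 1 else 0 := by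
    intro S
    rw [← Finset.card_filter, Finset.filter_filter, Nat.card_eq_fintype_card,
      Fintype.card_subtype]
    congr 1
    ext c
    simp [mem_vanishingOn, Finset.subset_iff, mem_supp]
  have h₂ : ∀ c : ι → F, (∑ S ∈ Finset.powersetCard r Finset.univ,
      if S ⊆ (supp c)ᶜ then 1 else 0) = (Fintype.card ι - hammingNorm c).choose r := by
    intro c
    rw [← card_supp, ← Finset.card_compl, ← Finset.card_powersetCard, ← Finset.card_filter]
    congr 1
    ext S
    simp [Finset.mem_powersetCard, and_comm]
  simp_rw [h₁]
  rw [Finset.sum_comm]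
  simp_rw [h₂]
  rw [← Finset.sum_fiberwise_of_maps_to (t := Finset.range (Fintype.card ι + 1))
    (g := fun c => hammingNorm c)
    (fun c _ => Finset.mem_range_succ_iff.2 hammingNorm_le_card_fintype)]
  refine Finset.sum_congr rfl fun w _ => ?_
  have h₃ : Finset.filter (fun c => hammingNorm c = w) (Finset.univ.filter (fun c => c ∈ C)) =
      wordsOfWeight C w := by
    ext c
    simp [mem_wordsOfWeight]
  rw [h₃, Finset.sum_congr rfl (g := fun _ => (Fintype.card ι - w).choose r)
    (fun c hc => by rw [(mem_wordsOfWeight.1 hc).2]), Finset.sum_const, smul_eq_mul,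
    weightCount]

/-- The system is unitriangular: for `r = n - k` the coefficient is `0` when `w > k` and `1` when `w
= k`. -/
theorem eq_of_binomial_moments_eq {n : ℕ} {a b : ℕ → ℕ}
    (h : ∀ r ≤ n, ∑ w ∈ Finset.range (n + 1), a w * (n - w).choose r =
      ∑ w ∈ Finset.range (n + 1), b w * (n - w).choose r) :
    ∀ k ≤ n, a k = b k := by
  intro k
  induction k using Nat.strong_induction_on with
  | _ k ih =>
    intro hk
    have key : ∀ f : ℕ → ℕ, ∑ w ∈ Finset.range (n + 1), f w * (n - w).choose (n - k) =
        ∑ w ∈ Finset.range k, f w * (n - w).choose (n - k) + f k := by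
      intro f
      rw [← Finset.sum_subset (Finset.range_mono (Nat.succ_le_succ hk)) (fun w _ hw => ?_),
        Finset.sum_range_succ, Nat.choose_self, mul_one]
      rw [Nat.choose_eq_zero_of_lt, mul_zero]
      simp at hw
      have := Finset.mem_range.1 ‹w ∈ _›
      omega
    have := h (n - k) (Nat.sub_le _ _)
    rw [key, key, Finset.sum_congr rfl fun w hw => by
      rw [ih w (Finset.mem_range.1 hw) ((Finset.mem_range.1 hw).le.trans hk)]] at this
    exact Nat.add_left_cancel this

theorem natCard_eq_sum_weightCount (C : Submodule F (ι → F)) :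
    Nat.card C = ∑ w ∈ Finset.range (Fintype.card ι + 1), weightCount C w := by
  have := sum_card_vanishingOn C 0
  simpa [vanishingOn] using this

/-- The power-moment form of the MacWilliams identities. -/
theorem card_mul_sum_weightCount_dual (C : Submodule F (ι → F)) {r : ℕ}
    (hr : r ≤ Fintype.card ι) :
    Nat.card C * ∑ w ∈ Finset.range (Fintype.card ι + 1),
        weightCount (dual C) w * (Fintype.card ι - w).choose r =
      (∑ w ∈ Finset.range (Fintype.card ι + 1),
        weightCount C w * (Fintype.card ι - w).choose (Fintype.card ι - r)) *
        Fintype.card F ^ (Fintype.card ι - r) := by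
  rw [← sum_card_vanishingOn, ← sum_card_vanishingOn, Finset.mul_sum, Finset.sum_mul]
  refine Finset.sum_nbij' (fun S => Sᶜ) (fun S => Sᶜ) ?_ ?_ (fun S _ => compl_compl S)
    (fun S _ => compl_compl S) ?_
  · intro S hS
    simp only [Finset.mem_powersetCard_univ] at hS ⊢
    rw [Finset.card_compl, hS]
  · intro S hS
    simp only [Finset.mem_powersetCard_univ] at hS ⊢
    rw [Finset.card_compl, hS]
    omega
  · intro S hS
    have := card_vanishingOn_dual_compl C Sᶜ
    rw [compl_compl, Finset.card_compl, Finset.mem_powersetCard_univ.1 hS] at this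
    exact this

/-- The weight distribution of a code determines that of its dual. -/
theorem weightCount_dual_congr {C : Submodule F (ι → F)} {D : Submodule F (κ → F)}
    (hcard : Fintype.card ι = Fintype.card κ) (h : ∀ k, weightCount C k = weightCount D k) :
    ∀ k, weightCount (dual C) k = weightCount (dual D) k := by
  intro k
  rcases lt_or_ge (Fintype.card ι) k with hk | hk
  · rw [weightCount_eq_zero _ hk, weightCount_eq_zero _ (hcard ▸ hk)]
  refine eq_of_binomial_moments_eq (n := Fintype.card ι) (fun r hr => ?_) k hk
  have hC := card_mul_sum_weightCount_dual C hr
  have hD := card_mul_sum_weightCount_dual D (hcard ▸ hr)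
  have hCD : Nat.card C = Nat.card D := by
    simp only [natCard_eq_sum_weightCount, hcard, h]
  rw [← hcard, ← hCD] at hD
  simp only [← h] at hD
  exact Nat.eq_of_mul_eq_mul_left (Nat.card_pos (α := C)) (hC.trans hD.symm)

/-! ### Puncturing and shortening -/

omit [Fintype F] [DecidableEq F] in
theorem dual_puncture (C : Submodule F (ι → F)) (T : Finset ι) :
    dual (puncture C T) = shorten (dual C) T := by
  ext y
  constructor
  · intro hy
    rw [mem_dual] at hy
    -- The preimage is `y` extended by zero on `T`.
    refine ⟨fun i => if h : i ∉ T then y ⟨i, h⟩ else 0, mem_vanishingOn.2 ⟨mem_dual.2 ?_, ?_⟩, ?_⟩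
    · intro x hx
      have := hy _ (Submodule.mem_map_of_mem hx)
      simp only [LinearMap.funLeft_apply] at this
      refine Eq.trans ?_ this
      rw [← Fintype.sum_subtype_add_sum_subtype (fun i => i ∉ T)]
      rw [Finset.sum_eq_zero (s := (Finset.univ : Finset {i // ¬ i ∉ T}))
        (fun i _ => by rw [dif_neg i.2, mul_zero]), add_zero]
      exact Finset.sum_congr rfl fun i _ => by rw [dif_pos i.2]
    · intro i hi
      simp [hi]
    · ext i
      simp [LinearMap.funLeft_apply, i.2]
  · rintro ⟨z, hz, rfl⟩
    obtain ⟨hz, hz0⟩ := mem_vanishingOn.1 hz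
    rw [mem_dual]
    rintro _ ⟨x, hx, rfl⟩
    rw [← mem_dual.1 hz x hx, ← Fintype.sum_subtype_add_sum_subtype (fun i => i ∉ T)]
    rw [Finset.sum_eq_zero (s := (Finset.univ : Finset {i // ¬ i ∉ T}))
      (fun i _ => by rw [hz0 i (not_not.1 i.2), mul_zero]), add_zero]
    rfl

theorem weightCount_puncture_congr_iff (C : Submodule F (ι → F)) {T₁ T₂ : Finset ι}
    (hT : T₁.card = T₂.card) :
    (∀ k, weightCount (puncture C T₁) k = weightCount (puncture C T₂) k) ↔
      ∀ k, weightCount (shorten (dual C) T₁) k = weightCount (shorten (dual C) T₂) k := by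
  have hcard : Fintype.card {i // i ∉ T₁} = Fintype.card {i // i ∉ T₂} := by
    simp [Fintype.card_subtype_compl, hT]
  rw [← dual_puncture, ← dual_puncture]
  refine ⟨weightCount_dual_congr hcard, fun h => ?_⟩
  simpa only [dual_dual] using weightCount_dual_congr hcard h

omit [Fintype F] in
theorem hammingNorm_funLeft_val (c : ι → F) (T : Finset ι) :
    hammingNorm (LinearMap.funLeft F F (Subtype.val : {i : ι // i ∉ T} → ι) c) =
      (supp c \ T).card := by
  rw [← card_supp, ← Finset.card_map (Function.Embedding.subtype _)]
  congr 1
  ext i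
  simp [mem_supp, LinearMap.funLeft_apply, and_comm]

open Classical in
/-- If no nonzero codeword is supported on `T`, puncturing on `T` is injective. -/
theorem weightCount_puncture (C : Submodule F (ι → F)) (T : Finset ι)
    (hC : ∀ c ∈ C, supp c ⊆ T → c = 0) (k : ℕ) :
    weightCount (puncture C T) k =
      (Finset.univ.filter (fun c => c ∈ C ∧ (supp c \ T).card = k)).card := by
  symm
  refine Finset.card_bij
    (fun c _ => LinearMap.funLeft F F (Subtype.val : {i : ι // i ∉ T} → ι) c) ?_ ?_ ?_
  · intro c hc
    simp only [Finset.mem_filter, Finset.mem_univ, true_and] at hc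
    exact mem_wordsOfWeight.2 ⟨Submodule.mem_map_of_mem hc.1,
      (hammingNorm_funLeft_val c T).trans hc.2⟩
  · intro a ha b hb hab
    simp only [Finset.mem_filter, Finset.mem_univ, true_and] at ha hb
    refine sub_eq_zero.1 (hC _ (C.sub_mem ha.1 hb.1) fun i hi => ?_)
    by_contra hiT
    have := congrFun hab ⟨i, hiT⟩
    simp only [LinearMap.funLeft_apply] at this
    exact mem_supp.1 hi (by simp [this])
  · intro y hy
    obtain ⟨⟨c, hc, rfl⟩, hw⟩ := mem_wordsOfWeight.1 hy
    refine ⟨c, ?_, rfl⟩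
    simp only [Finset.mem_filter, Finset.mem_univ, true_and]
    exact ⟨hc, (hammingNorm_funLeft_val c T).symm.trans hw⟩

/-! ### Codewords with prescribed nonzero and zero coordinates -/

/-- The number of codewords of weight `w` that are nonzero on `A` and zero on `B`. -/
noncomputable def countIn (C : Submodule F (ι → F)) (w : ℕ) (A B : Finset ι) : ℕ :=
  ((wordsOfWeight C w).filter (fun c => A ⊆ supp c ∧ Disjoint B (supp c))).card

theorem countIn_split (C : Submodule F (ι → F)) (w : ℕ) (A B : Finset ι) (x : ι) :
    countIn C w A B = countIn C w (insert x A) B + countIn C w A (insert x B) := by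
  unfold countIn
  rw [← Finset.card_filter_add_card_filter_not (fun c : ι → F => x ∈ supp c),
    Finset.filter_filter, Finset.filter_filter]
  congr 2
  · ext c
    simp only [Finset.mem_filter, Finset.insert_subset_iff]
    tauto
  · ext c
    simp only [Finset.mem_filter, Finset.disjoint_insert_left]
    tauto

theorem weightCount_shorten (C : Submodule F (ι → F)) (T : Finset ι) (k : ℕ) :
    weightCount (shorten C T) k = countIn C k ∅ T := by
  classical
  rw [shorten, weightCount_puncture, countIn]
  · congr 1
    ext c
    simp only [Finset.mem_filter, Finset.mem_univ, true_and, mem_wordsOfWeight,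
      mem_vanishingOn, Finset.empty_subset]
    have h : (∀ i ∈ T, c i = 0) ↔ Disjoint T (supp c) := by
      simp [Finset.disjoint_left, mem_supp]
    rw [h]
    constructor
    · rintro ⟨⟨h₁, h₂⟩, h₃⟩
      rw [Finset.sdiff_eq_self_of_disjoint h₂.symm] at h₃
      exact ⟨⟨h₁, h₃⟩, h₂⟩
    · rintro ⟨⟨h₁, h₃⟩, h₂⟩
      rw [Finset.sdiff_eq_self_of_disjoint h₂.symm]
      exact ⟨⟨h₁, h₂⟩, h₃⟩
  · intro c hc hcT
    ext i
    by_contra hi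
    exact hi ((mem_vanishingOn.1 hc).2 i (hcT (mem_supp.2 hi)))

-- Words are sorted by `S = T ∩ supp c`; weight `k` off `T` then means total weight `k + #S`.
open Classical in
theorem card_filter_sdiff_eq_sum (C : Submodule F (ι → F)) (T : Finset ι) (k : ℕ) :
    (Finset.univ.filter (fun c => c ∈ C ∧ (supp c \ T).card = k)).card =
      ∑ S ∈ T.powerset, countIn C (k + S.card) S (T \ S) := by
  rw [Finset.card_eq_sum_card_fiberwise (f := fun c => T ∩ supp c) (t := T.powerset)
    (fun c _ => by simp)]
  refine Finset.sum_congr rfl fun S hS => ?_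
  rw [Finset.mem_powerset] at hS
  unfold countIn
  congr 1
  ext c
  simp only [Finset.mem_filter, Finset.mem_univ, true_and, mem_wordsOfWeight]
  have hiff : T ∩ supp c = S ↔ S ⊆ supp c ∧ Disjoint (T \ S) (supp c) := by
    constructor
    · rintro rfl
      refine ⟨Finset.inter_subset_right, ?_⟩
      rw [Finset.disjoint_left]
      intro i hi hc
      simp_all
    · rintro ⟨h₁, h₂⟩
      rw [Finset.disjoint_left] at h₂
      ext i
      have := @h₁ i
      have := @hS i
      have := @h₂ i
      simp only [Finset.mem_sdiff, Finset.mem_inter] at *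
      tauto
  rw [← hiff, ← card_supp]
  have := Finset.card_sdiff_add_card_inter (supp c) T
  rw [Finset.inter_comm] at this
  constructor
  · rintro ⟨⟨h₁, h₂⟩, rfl⟩
    exact ⟨⟨h₁, by omega⟩, rfl⟩
  · rintro ⟨⟨h₁, h₂⟩, rfl⟩
    exact ⟨⟨h₁, by omega⟩, rfl⟩

end LinearCode

/-! ### Set functions depending only on cardinalities -/

theorem exists_eq_apply_card {α β : Type*} [Nonempty β] {t : ℕ} {N : Finset α → β}
    (h : ∀ A B : Finset α, A.card = B.card → A.card ≤ t → N A = N B) :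
    ∃ f : ℕ → β, ∀ A : Finset α, A.card ≤ t → N A = f A.card := by
  classical
  refine ⟨fun j => if h : ∃ A : Finset α, A.card = j then N h.choose
    else Classical.arbitrary β, fun A hA => ?_⟩
  have hex : ∃ B : Finset α, B.card = A.card := ⟨A, rfl⟩
  simp only [dif_pos hex]
  exact h _ _ hex.choose_spec.symm hA

/-- If `G A B = G (A ∪ {x}) B + G A (B ∪ {x})` and `G A ∅` depends only on the size of `A`, then
`G A B` depends only on the sizes of `A` and `B`. -/
theorem exists_eq_apply_card_card {α : Type*} [DecidableEq α] {t : ℕ}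
    {G : Finset α → Finset α → ℕ}
    (hsplit : ∀ A B x, G A B = G (insert x A) B + G A (insert x B))
    (h : ∀ A B : Finset α, A.card = B.card → A.card ≤ t → G A ∅ = G B ∅) :
    ∃ g : ℕ → ℕ → ℕ, ∀ A B : Finset α, Disjoint A B → A.card + B.card ≤ t →
      G A B = g A.card B.card := by
  obtain ⟨f, hf⟩ := exists_eq_apply_card h
  -- The recursion is `g a 0 = f a`, `g a (b + 1) = g a b - g (a + 1) b`. By `hsplit` the truncated
  -- subtraction is exact wherever it is used.
  refine ⟨fun a b => Nat.rec (motive := fun _ => ℕ → ℕ) f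
    (fun _ ih a => ih a - ih (a + 1)) b a, fun A B => ?_⟩
  induction B using Finset.induction_on generalizing A with
  | empty =>
    intro _ hA
    exact hf A (by simpa using hA)
  | insert x B hx ih =>
    intro hAB hcard
    rw [Finset.disjoint_insert_right] at hAB
    rw [Finset.card_insert_of_notMem hx] at hcard ⊢
    have h₁ := ih A hAB.2 (by omega)
    have h₂ := ih (insert x A) (Finset.disjoint_insert_left.2 ⟨hx, hAB.2⟩)
      (by rw [Finset.card_insert_of_notMem hAB.1]; omega)
    rw [Finset.card_insert_of_notMem hAB.1] at h₂
    have h₃ := hsplit A B x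
    simp only at h₁ h₂ ⊢
    rw [← h₁, ← h₂]
    omega

/-! ### Dividing multiplicities, and blocks counted by codewords -/

theorem mul_card_filter_divMultiplicity {α : Type*} [DecidableEq α] {m : ℕ} (S : Multiset α)
    (p : α → Prop) [DecidablePred p] (h : ∀ a, p a → m ∣ S.count a) :
    m * ((divMultiplicity m S).filter p).card = (S.filter p).card := by
  have h₁ : ((divMultiplicity m S).filter p).card =
      ∑ a ∈ S.toFinset, if p a then S.count a / m else 0 := by
    rw [← Multiset.countP_eq_card_filter, divMultiplicity, ← Multiset.coe_countPAddMonoidHom,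
      map_sum]
    refine Finset.sum_congr rfl fun a _ => ?_
    rw [Multiset.coe_countPAddMonoidHom, Multiset.countP_eq_card_filter]
    split_ifs with ha
    · rw [Multiset.filter_eq_self.2 (fun b hb => Multiset.eq_of_mem_replicate hb ▸ ha),
        Multiset.card_replicate]
    · rw [Multiset.filter_eq_nil.2 (fun b hb => Multiset.eq_of_mem_replicate hb ▸ ha),
        Multiset.card_zero]
  rw [h₁, ← Multiset.toFinset_sum_count_eq, Multiset.toFinset_filter, Finset.sum_filter,
    Finset.mul_sum]
  refine Finset.sum_congr rfl fun a _ => ?_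
  split_ifs with ha
  · rw [Nat.mul_div_cancel' (h a ha), Multiset.count_filter_of_pos ha]
  · rw [mul_zero]

theorem mem_of_mem_divMultiplicity {α : Type*} [DecidableEq α] {m : ℕ} {S : Multiset α} {a : α}
    (h : a ∈ divMultiplicity m S) : a ∈ S := by
  obtain ⟨b, hb, hab⟩ := Multiset.mem_sum.1 h
  rw [Multiset.eq_of_mem_replicate hab]
  exact Multiset.mem_toFinset.1 hb

namespace LinearCode

variable {F ι : Type*} [Field F] [Fintype F] [DecidableEq F] [Fintype ι] [DecidableEq ι]

omit [Fintype F] [DecidableEq ι] in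
theorem supp_smul {a : F} (ha : a ≠ 0) (c : ι → F) : supp (a • c) = supp c := by
  ext i
  simp [mem_supp, ha]

/-- The number of codewords with a given nonempty support is divisible by `#F - 1`. -/
theorem card_sub_one_dvd_card_supp_eq (C : Submodule F (ι → F)) (w : ℕ) {S : Finset ι}
    (hS : S.Nonempty) :
    Fintype.card F - 1 ∣ ((wordsOfWeight C w).filter (fun c => supp c = S)).card := by
  obtain ⟨i, hi⟩ := hS
  have hmaps : ∀ c ∈ (wordsOfWeight C w).filter (fun c => supp c = S),
      c i ∈ Finset.univ.erase (0 : F) := by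
    intro c hc
    have := (Finset.mem_filter.1 hc).2
    simpa using mem_supp.1 (this ▸ hi)
  -- Group by the value at `i ∈ S`: there are `q - 1` nonzero values, and scaling by `a⁻¹` carries
  -- the fibre over `a` onto the fibre over `1`.
  rw [Finset.card_eq_sum_card_fiberwise (f := fun c => c i)
      (t := Finset.univ.erase (0 : F)) (fun c hc => hmaps c (Finset.mem_coe.1 hc)),
    Finset.sum_const_nat (m := (((wordsOfWeight C w).filter (fun c => supp c = S)).filter
      (fun c => c i = 1)).card), Finset.card_erase_of_mem (Finset.mem_univ _), Finset.card_univ]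
  · exact dvd_mul_right _ _
  · intro a ha
    have ha0 : a ≠ 0 := Finset.ne_of_mem_erase ha
    have hmem : ∀ {b : F}, b ≠ 0 → ∀ {c : ι → F},
        (c ∈ wordsOfWeight C w ∧ supp c = S) → b • c ∈ wordsOfWeight C w ∧ supp (b • c) = S := by
      rintro b hb c ⟨hc, hcS⟩
      rw [mem_wordsOfWeight] at hc ⊢
      refine ⟨⟨C.smul_mem b hc.1, ?_⟩, (supp_smul hb c).trans hcS⟩
      rw [← card_supp, supp_smul hb, card_supp, hc.2]
    refine Finset.card_nbij' (fun c => a⁻¹ • c) (fun c => a • c) ?_ ?_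
      (fun c _ => smul_inv_smul₀ ha0 c) (fun c _ => inv_smul_smul₀ ha0 c)
    · intro c hc
      simp only [Finset.coe_filter, Set.mem_ofPred_eq, Finset.mem_filter] at hc ⊢
      exact ⟨hmem (inv_ne_zero ha0) hc.1, by simp [hc.2, ha0]⟩
    · intro c hc
      simp only [Finset.coe_filter, Set.mem_ofPred_eq, Finset.mem_filter] at hc ⊢
      exact ⟨hmem ha0 hc.1, by simp [hc.2]⟩

/-- The number of blocks containing a nonempty set, in terms of codewords. -/
theorem mul_card_filter_blocks (C : Submodule F (ι → F)) (w : ℕ) {T : Finset ι}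
    (hT : T.Nonempty) :
    (Fintype.card F - 1) * ((blocks C w).filter (fun b => T ⊆ b)).card = countIn C w T ∅ := by
  rw [blocks, mul_card_filter_divMultiplicity]
  · rw [Multiset.filter_map, Multiset.card_map, countIn]
    simp only [Finset.disjoint_empty_left, and_true]
    rfl
  -- Exact division is needed only for supports containing `T`, which are nonempty.
  · intro S hS
    have := card_sub_one_dvd_card_supp_eq C w (hT.mono hS)
    rwa [Multiset.count_map, ← Finset.filter_val, Finset.card_val,
      Finset.filter_congr fun c _ => eq_comm]

theorem supportsDesigns_iff (C : Submodule F (ι → F)) {t : ℕ} (ht : 0 < t)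
    (htn : t ≤ Fintype.card ι) :
    SupportsDesigns C t ↔ ∀ k, ∀ A B : Finset ι, A.card = t → B.card = t →
      countIn C k A ∅ = countIn C k B ∅ := by
  have hne : ∀ {A : Finset ι}, A.card = t → A.Nonempty := fun hA =>
    Finset.card_pos.1 (hA ▸ ht)
  constructor
  · intro h k A B hA hB
    rcases le_or_gt k (Fintype.card ι) with hk | hk
    · obtain ⟨lam, hlam⟩ := h k hk
      rw [← mul_card_filter_blocks C k (hne hA), ← mul_card_filter_blocks C k (hne hB),
        hlam.card_containing A hA, hlam.card_containing B hB]
    · have h0 := Finset.card_eq_zero.1 (weightCount_eq_zero C hk)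
      simp [countIn, h0]
  · intro h k hk
    obtain ⟨A, -, hA⟩ := Finset.exists_subset_card_eq
      (s := (Finset.univ : Finset ι)) (n := t) (by simpa using htn)
    refine ⟨((blocks C k).filter (fun b => A ⊆ b)).card, ht, htn, hk, ?_, ?_⟩
    · intro b hb
      obtain ⟨c, hc, rfl⟩ := Multiset.mem_map.1 (mem_of_mem_divMultiplicity hb)
      exact (mem_wordsOfWeight.1 hc).2
    · intro T hT
      have hq : 0 < Fintype.card F - 1 := Nat.sub_pos_of_lt Fintype.one_lt_card
      refine Nat.eq_of_mul_eq_mul_left hq ?_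
      rw [mul_card_filter_blocks C k (hne hT), mul_card_filter_blocks C k (hne hA)]
      exact h k T A hT hA

/-! ### Regularity of supports -/

omit [Fintype F] [DecidableEq ι] in
theorem lt_hammingNorm {C : Submodule F (ι → F)} {t : ℕ} (ht : t < minDist C) {c : ι → F}
    (hc : c ∈ C) (hc0 : c ≠ 0) : t < hammingNorm c :=
  ht.trans_le (Nat.sInf_le ⟨c, hc, 0, C.zero_mem, hc0, hammingDist_zero_right c⟩)

omit [Fintype F] [DecidableEq ι] in
theorem le_card_of_lt_minDist {C : Submodule F (ι → F)} {t : ℕ} (ht : t < minDist C) :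
    t ≤ Fintype.card ι := by
  -- As `sInf ∅ = 0`, a positive minimum distance provides two distinct codewords.
  have hne := Nat.nonempty_of_pos_sInf (Nat.zero_lt_of_lt ht)
  obtain ⟨x, -, y, -, -, hxy⟩ := Nat.sInf_mem hne
  have : t < hammingDist x y := hxy ▸ ht
  exact this.le.trans hammingDist_le_card_fintype

/-- `countIn C k A ∅` is the same for all sets `A` of the same size at most `t`. -/
def NonzeroRegular (C : Submodule F (ι → F)) (t : ℕ) : Prop :=
  ∀ k, ∀ A B : Finset ι, A.card = B.card → A.card ≤ t → countIn C k A ∅ = countIn C k B ∅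

/-- `countIn C k ∅ A` is the same for all sets `A` of the same size at most `t`. -/
def ZeroRegular (C : Submodule F (ι → F)) (t : ℕ) : Prop :=
  ∀ k, ∀ A B : Finset ι, A.card = B.card → A.card ≤ t → countIn C k ∅ A = countIn C k ∅ B

theorem nonzeroRegular_iff_zeroRegular (C : Submodule F (ι → F)) (t : ℕ) :
    NonzeroRegular C t ↔ ZeroRegular C t := by
  constructor
  · intro h k A B hAB hA
    obtain ⟨g, hg⟩ := exists_eq_apply_card_card (countIn_split C k) (h k)
    rw [hg ∅ A (by simp) (by simpa using hA), hg ∅ B (by simp) (by simpa [← hAB] using hA), hAB]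
  · intro h k A B hAB hA
    -- The splitting rule is symmetric, so the same argument applies with the two sets exchanged.
    obtain ⟨g, hg⟩ := exists_eq_apply_card_card (G := fun A B => countIn C k B A)
      (fun A B x => (countIn_split C k B A x).trans (add_comm _ _)) (h k)
    rw [hg ∅ A (by simp) (by simpa using hA), hg ∅ B (by simp) (by simpa [← hAB] using hA), hAB]

/-- Each word counted by `countIn C k A ∅` contributes once for every `x` in `supp c \ A`. -/
theorem sum_countIn_insert (C : Submodule F (ι → F)) (k : ℕ) (A : Finset ι) :
    ∑ x ∈ Aᶜ, countIn C k (insert x A) ∅ = countIn C k A ∅ * (k - A.card) := by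
  have h : ∀ x, countIn C k (insert x A) ∅ =
      ∑ c ∈ (wordsOfWeight C k).filter (fun c => A ⊆ supp c), if x ∈ supp c then 1 else 0 := by
    intro x
    rw [← Finset.card_filter, Finset.filter_filter, countIn]
    congr 1
    ext c
    simp only [Finset.mem_filter, Finset.insert_subset_iff, Finset.disjoint_empty_left, and_true]
    tauto
  simp_rw [h]
  rw [Finset.sum_comm, Finset.sum_const_nat (m := k - A.card)]
  · simp [countIn]
  · intro c hc
    obtain ⟨hc, hA⟩ := Finset.mem_filter.1 hc
    rw [← Finset.card_filter, ← (mem_wordsOfWeight.1 hc).2, ← card_supp,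
      ← Finset.card_sdiff_of_subset hA]
    congr 1
    ext i
    simp [and_comm]

/-- Only the zero word can have weight at most `t`, and it is counted exactly when the set is empty.
-/
theorem countIn_congr_of_le {C : Submodule F (ι → F)} {t k : ℕ} (ht : t < minDist C)
    (hk : k ≤ t) {A B : Finset ι} (hAB : A.card = B.card) :
    countIn C k A ∅ = countIn C k B ∅ := by
  unfold countIn
  congr 1
  refine Finset.filter_congr fun c hc => ?_
  have hc0 : c = 0 := by
    by_contra hne
    obtain ⟨hcC, hw⟩ := mem_wordsOfWeight.1 hc
    have := lt_hammingNorm ht hcC hne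
    omega
  have hs : supp c = ∅ := by
    ext i
    simp [mem_supp, hc0]
  have : A = ∅ ↔ B = ∅ := by rw [← Finset.card_eq_zero, hAB, Finset.card_eq_zero]
  simp [hs, Finset.subset_empty, this]

theorem supportsDesigns_iff_nonzeroRegular {C : Submodule F (ι → F)} {t : ℕ} (ht : 0 < t)
    (htd : t < minDist C) : SupportsDesigns C t ↔ NonzeroRegular C t := by
  have htn := le_card_of_lt_minDist htd
  rw [supportsDesigns_iff C ht htn]
  refine ⟨fun h k => ?_, fun h k A B hA hB => h k A B (hA.trans hB.symm) hA.le⟩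
  rcases le_or_gt k t with hk | hk
  · exact fun A B hAB _ => countIn_congr_of_le htd hk hAB
  suffices H : ∀ j ≤ t, ∀ A B : Finset ι, A.card = j → B.card = j →
      countIn C k A ∅ = countIn C k B ∅ from
    fun A B hAB hA => H A.card hA A B rfl hAB.symm
  intro j hj
  induction hj using Nat.decreasingInduction with
  | self => exact h k
  | of_succ j hj ih =>
    intro A B hA hB
    obtain ⟨D, -, hD⟩ := Finset.exists_subset_card_eq
      (s := (Finset.univ : Finset ι)) (n := j + 1) (by simpa using hj.trans_le htn)
    have key : ∀ E : Finset ι, E.card = j →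
        countIn C k E ∅ * (k - j) = (Fintype.card ι - j) * countIn C k D ∅ := by
      intro E hE
      have := sum_countIn_insert C k E
      rw [Finset.sum_const_nat (m := countIn C k D ∅) (fun x hx => ih _ _ (by
        rw [Finset.card_insert_of_notMem (Finset.mem_compl.1 hx), hE]) hD),
        Finset.card_compl, hE] at this
      exact this.symm
    -- The factor `k - j` cancels because `j < t < k`; this is why `k ≤ t` was treated apart.
    exact Nat.eq_of_mul_eq_mul_right (by omega) ((key A hA).trans (key B hB).symm)

theorem weightCount_puncture_congr {C : Submodule F (ι → F)} {t : ℕ} (htd : t < minDist C)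
    (h : NonzeroRegular C t) {T₁ T₂ : Finset ι} (hT : T₁.card = T₂.card) (hT₁ : T₁.card ≤ t)
    (k : ℕ) : weightCount (puncture C T₁) k = weightCount (puncture C T₂) k := by
  choose g hg using fun w => exists_eq_apply_card_card (countIn_split C w) (h w)
  have key : ∀ T : Finset ι, T.card ≤ t → weightCount (puncture C T) k =
      ∑ S ∈ T.powerset, g (k + S.card) S.card (T.card - S.card) := by
    intro T hTt
    rw [weightCount_puncture, card_filter_sdiff_eq_sum]
    · refine Finset.sum_congr rfl fun S hS => ?_
      rw [Finset.mem_powerset] at hS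
      have := Finset.card_le_card hS
      rw [hg _ S (T \ S) Finset.disjoint_sdiff, Finset.card_sdiff_of_subset hS]
      rw [Finset.card_sdiff_of_subset hS]
      omega
    -- A nonzero word has weight above `t ≥ #T`, so none is supported in `T`.
    · intro c hc hcT
      by_contra hc0
      have := lt_hammingNorm htd hc hc0
      have := Finset.card_le_card hcT
      rw [card_supp] at this
      omega
  rw [key T₁ hT₁, key T₂ (hT ▸ hT₁),
    Finset.sum_powerset_apply_card (fun j => g (k + j) j (T₁.card - j)),
    Finset.sum_powerset_apply_card (fun j => g (k + j) j (T₂.card - j)), hT]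

theorem zeroRegular_iff_shorten (C : Submodule F (ι → F)) (t : ℕ) :
    ZeroRegular C t ↔ ∀ T₁ T₂ : Finset ι, T₁.card = T₂.card → T₁.card ≤ t →
      ∀ k, weightCount (shorten C T₁) k = weightCount (shorten C T₂) k := by
  simp only [weightCount_shorten]
  exact ⟨fun h T₁ T₂ h₁ h₂ k => h k T₁ T₂ h₁ h₂, fun h k T₁ T₂ h₁ h₂ => h T₁ T₂ h₁ h₂ k⟩

theorem zeroRegular_dual_iff_puncture (C : Submodule F (ι → F)) (t : ℕ) :
    ZeroRegular (dual C) t ↔ ∀ T₁ T₂ : Finset ι, T₁.card = T₂.card → T₁.card ≤ t →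
      ∀ k, weightCount (puncture C T₁) k = weightCount (puncture C T₂) k := by
  rw [zeroRegular_iff_shorten]
  exact forall₄_congr fun T₁ T₂ hT _ => (weightCount_puncture_congr_iff C hT).symm

theorem NonzeroRegular.dual {C : Submodule F (ι → F)} {t : ℕ} (htd : t < minDist C)
    (h : NonzeroRegular C t) : NonzeroRegular (dual C) t := by
  rw [nonzeroRegular_iff_zeroRegular, zeroRegular_dual_iff_puncture]
  exact fun T₁ T₂ hT hT₁ k => weightCount_puncture_congr htd h hT hT₁ k

/-- The restrictions `1 ≤ #T` and `k ≤ n - #T` are immaterial when comparing weight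
distributions. -/
theorem forall_weightCount_congr_iff {n t : ℕ}
    (D : (T : Finset (Fin n)) → Submodule F ({i // i ∉ T} → F)) :
    (∀ t' : ℕ, 1 ≤ t' → t' ≤ t → ∀ T₁ T₂ : Finset (Fin n), T₁.card = t' → T₂.card = t' →
      ∀ k ≤ n - t', weightCount (D T₁) k = weightCount (D T₂) k) ↔
    ∀ T₁ T₂ : Finset (Fin n), T₁.card = T₂.card → T₁.card ≤ t →
      ∀ k, weightCount (D T₁) k = weightCount (D T₂) k := by
  constructor
  · intro h T₁ T₂ hT hT₁ k
    rcases Nat.eq_zero_or_pos T₁.card with h0 | hpos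
    · have h0' := hT ▸ h0
      rw [Finset.card_eq_zero] at h0 h0'
      rw [h0, h0']
    rcases le_or_gt k (n - T₁.card) with hk | hk
    · exact h _ hpos hT₁ T₁ T₂ rfl hT.symm k hk
    · rw [weightCount_eq_zero, weightCount_eq_zero]
      · simpa [Fintype.card_subtype_compl, ← hT] using hk
      · simpa [Fintype.card_subtype_compl] using hk
  · intro h t' _ ht' T₁ T₂ h₁ h₂ k _
    exact h T₁ T₂ (h₁.trans h₂.symm) (h₁.le.trans ht') k

end LinearCode

theorem mainTheorem2 {F : Type*} [Field F] [Fintype F] [DecidableEq F] (n : ℕ)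
    (C : Submodule F (Fin n → F)) (t : ℕ) (ht : 0 < t)
    (htd : t < min (LinearCode.minDist C) (LinearCode.minDist (LinearCode.dual C))) :
    List.TFAE [
      LinearCode.SupportsDesigns C t,
      LinearCode.SupportsDesigns (LinearCode.dual C) t,
      ∀ t' : ℕ, 1 ≤ t' → t' ≤ t → ∀ T₁ T₂ : Finset (Fin n), T₁.card = t' → T₂.card = t' →
        ∀ k ≤ n - t', LinearCode.weightCount (LinearCode.shorten C T₁) k =
          LinearCode.weightCount (LinearCode.shorten C T₂) k,
      ∀ t' : ℕ, 1 ≤ t' → t' ≤ t → ∀ T₁ T₂ : Finset (Fin n), T₁.card = t' → T₂.card = t' →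
        ∀ k ≤ n - t', LinearCode.weightCount (LinearCode.puncture C T₁) k =
          LinearCode.weightCount (LinearCode.puncture C T₂) k] := by
  rw [lt_min_iff] at htd
  rw [LinearCode.forall_weightCount_congr_iff (LinearCode.shorten C),
    LinearCode.forall_weightCount_congr_iff (LinearCode.puncture C),
    LinearCode.supportsDesigns_iff_nonzeroRegular ht htd.1,
    LinearCode.supportsDesigns_iff_nonzeroRegular ht htd.2,
    ← LinearCode.zeroRegular_iff_shorten, ← LinearCode.zeroRegular_dual_iff_puncture]
  tfae_have 1 → 2 := LinearCode.NonzeroRegular.dual htd.1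
  tfae_have 2 → 1 := fun h => LinearCode.dual_dual C ▸ LinearCode.NonzeroRegular.dual htd.2 h
  tfae_have 1 ↔ 3 := LinearCode.nonzeroRegular_iff_zeroRegular C t
  tfae_have 2 ↔ 4 := LinearCode.nonzeroRegular_iff_zeroRegular (LinearCode.dual C) t
  tfae_finish
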